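/- Let $\Gamma=(\mathbf V,\mathbf E)$ be a finite connected graph without loops and with at least one edge: $\mathbf E$ is the set of directed edges, $\mathrm o(e)$ is the origin of $e$, $e\mapsto -e$ is a fixed point free involution, $\mathrm t(e)=\mathrm o(-e)$, any two vertices are linked by a path, and $\mathrm o(e)\ne \mathrm t(e)$ for all $e$. A path is a nonempty finite sequence of concatenated edges, and a cycle is a closed path. Let $\mathfrak C_1(\Gamma,\mathbb R)$ be the real vector space generated by the edges with $-e$ identified with the opposite of $e$, let $\partial e=\mathrm t(e)-\mathrm o(e)$ and $H_1(\Gamma,\mathbb R)=\ker\partial$. Let $\mathfrak C^1(\Gamma,\mathbb R)$ be the space of functions $\omega:\mathbf E\to\mathbb R$ with $\omega(-e)=-\omega(e)$ (we write $\langle\omega,e\rangle=\omega(e)$), let $\langle dg,e\rangle=g(\mathrm t(e))-g(\mathrm o(e))$ for $g:\mathbf V\to\mathbb R$, and $H^1(\Gamma,\mathbb R)=\mathfrak C^1(\Gamma,\mathbb R)/\mathrm{Im}\, d$; $\langle c,h\rangle$ denotes the induced pairing of $H^1$ with $H_1$. Let $\mathcal H(e,\cdot):\mathbb R\to\mathbb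 R$, $e\in\mathbf E$, be strictly convex, differentiable functions with $\mathcal H(e,p)=\mathcal H(-e,-p)$ and $\mathcal H(e,p)/|p|\to+\infty$ as $p\to\pm\infty$. Let $p_e$ be the minimizer of $\mathcal H(e,\cdot)$, $a_e=\mathcal H(e,p_e)$, and $$a_0=\max_{e\in\mathbf E}a_e=\max_{e\in\mathbf E}\min_{p\in\mathbb R}\mathcal H(e,p).$$ Let $\sigma(e,\cdot):[a_e,+\infty)\to[p_e,+\infty)$ be the inverse of $\mathcal H(e,\cdot)|_{[p_e,+\infty)}$ and $\mathcal L(e,q)=\max_p\,(pq-\mathcal H(e,p))$. Let $T\Gamma=\mathbf E\times[0,+\infty)/\!\sim$ with $(e,0)\sim(-e,0)$, and let $\mathbb M$ be the set of Borel probability measures $\mu$ on $T\Gamma$ with $\int q\,d\mu<+\infty$ that are closed, i.e. $\int \langle df,q\,e\rangle\,d\mu(e,q)=0$ for all $f:\mathbf V\to\mathbb R$. Set $\rho(\mu)=\sum_{e\in\mathbf E}\big(\int_{\{e\}\times[0,+\infty)}q\,d\mu\big)\,e\in H_1(\Gamma,\mathbb R)$ for $\mu \in \mathbb M$. Define Mather's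 functions $$\beta(h)=\min\Big\{\int\mathcal L\,d\mu:\ \mu\in\mathbb M,\ \rho(\mu)=h\Big\}\quad (h\in H_1(\Gamma,\mathbb R)),\qquad \alpha(c)=\max_{h\in H_1(\Gamma,\mathbb R)}\big(\langle c,h\rangle-\beta(h)\big)\quad (c\in H^1(\Gamma,\mathbb R)).$$ For $\omega\in\mathfrak C^1(\Gamma,\mathbb R)$ of class $c$ put $\mathcal H^\omega(e,p)=\mathcal H(e,p+\langle\omega,e\rangle)$ and $\sigma^\omega(e,a)=\sigma(e,a)-\langle\omega,e\rangle$. A function $u:\mathbf V\to\mathbb R$ is a subsolution at level $a$ if $\max_{e:\,\mathrm t(e)=x}\mathcal H^\omega(e,\langle du,e\rangle)\le a$ for all $x\in\mathbf V$. The critical value $\widetilde\alpha(c)$ is the minimum of the levels $a$ for which subsolutions exist; it depends only on $c$. The Aubry set $\mathcal A_c$ is the set of edges belonging to some cycle $(e_i)_{i=1}^M$ with $\sum_i\sigma^\omega(e_i,\widetilde\alpha(c))=0$. The function $\mathcal Q_c:\mathcal A_c\to\mathbb R$ is $\mathcal Q_c(e)=\frac{\partial}{\partial p}\mathcal H^\omega(e,\langle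 du,e\rangle)$, where $u$ is any subsolution at level $\widetilde\alpha(c)$; neither $\mathcal A_c$ nor $\mathcal Q_c$ depends on the choice of $\omega$ in the class $c$, and $\mathcal Q_c$ does not depend on the choice of $u$. Then the minimum of $\alpha$ over $H^1(\Gamma,\mathbb R)$ exists and equals $a_0$. Moreover, $c\in H^1(\Gamma,\mathbb R)$ is a minimizer of $\alpha$ if and only if $\mathcal Q_c(e)=0$ for some $e\in\mathcal A_c$. -/

import Mathlib

open MeasureTheory Filter
open scoped NNReal

noncomputable section

namespace AubryMather

/-- A graph in the sense of Serre: vertices `V`, directed edges `E`, the origin map and the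
fixed point free involution `e ↦ -e`, here called `rev`. -/
structure DirGraph (V E : Type*) where
  origin : E → V
  rev : E → E
  rev_ne : ∀ e, rev e ≠ e
  rev_rev : ∀ e, rev (rev e) = e

namespace DirGraph

variable {V E : Type*} (G : DirGraph V E)

/-- The terminal vertex of an edge. -/
def terminal (e : E) : V := G.origin (G.rev e)

lemma terminal_rev (e : E) : G.terminal (G.rev e) = G.origin e := by
  simp [terminal, G.rev_rev]

/-- `G.Concatenated x l y`: the list of edges `l` is concatenated, starts at `x`, ends at `y`
(the empty list does so only when `x = y`). -/
def Concatenated : V → List E → V → Prop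
  | x, [], y => x = y
  | x, e :: l, y => G.origin e = x ∧ Concatenated (G.terminal e) l y

/-- A path from `x` to `y`: a nonempty finite sequence of concatenated edges. -/
def IsPath (x : V) (l : List E) (y : V) : Prop := l ≠ [] ∧ G.Concatenated x l y

/-- A closed path, or cycle. -/
def IsCycle (l : List E) : Prop := ∃ x, G.IsPath x l x

/-- Any two vertices are linked by some path. -/
def Connected : Prop := ∀ x y : V, ∃ l, G.IsPath x l y

/-- There are no edges whose origin and terminal vertex coincide. -/
def NoLoops : Prop := ∀ e, G.origin e ≠ G.terminal e

/-! ### Chains and homology -/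

/-- The relations `(-e) + e = 0` in the free real vector space on the edges. -/
def edgeRelations : Submodule ℝ (E →₀ ℝ) :=
  Submodule.span ℝ (Set.range fun e => Finsupp.single (G.rev e) (1 : ℝ) + Finsupp.single e 1)

/-- The `1`-chains with real coefficients: the free vector space on the edges, in which the
reversed edge is made to coincide with the opposite of the edge. -/
abbrev Chain1 : Type _ := (E →₀ ℝ) ⧸ G.edgeRelations

/-- The `1`-chain given by an edge. -/
def edgeChain (e : E) : G.Chain1 := G.edgeRelations.mkQ (Finsupp.single e 1)

/-- The boundary on the free vector space on the edges. -/
def preBoundary : (E →₀ ℝ) →ₗ[ℝ] (V →₀ ℝ) :=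
  Finsupp.linearCombination ℝ
    fun e => Finsupp.single (G.terminal e) (1 : ℝ) - Finsupp.single (G.origin e) 1

lemma edgeRelations_le_ker_preBoundary : G.edgeRelations ≤ LinearMap.ker G.preBoundary := by
  rw [edgeRelations, Submodule.span_le]
  rintro _ ⟨e, rfl⟩
  simp [preBoundary, terminal, G.rev_rev]

/-- The boundary operator, `∂ e = t(e) - o(e)`; the `0`-chains are `V →₀ ℝ`. -/
def boundary : G.Chain1 →ₗ[ℝ] (V →₀ ℝ) :=
  G.edgeRelations.liftQ G.preBoundary G.edgeRelations_le_ker_preBoundary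

/-- The first homology group `H_1(Γ, ℝ) = Ker ∂`. -/
abbrev Homology1 : Submodule ℝ G.Chain1 := LinearMap.ker G.boundary

/-! ### Cochains and cohomology -/

/-- The `1`-cochains: functions on the edges with `η (-e) = - η e`. -/
def Cochain1 : Submodule ℝ (E → ℝ) where
  carrier := {η | ∀ e, η (G.rev e) = - η e}
  add_mem' := by
    intro a b ha hb e
    simp [ha e, hb e]
    ring
  zero_mem' := by intro e; simp
  smul_mem' := by
    intro r a ha e
    simp [ha e]

/-- The coboundary operator, `dg (e) = g(t(e)) - g(o(e))`; the `0`-cochains are `V → ℝ`. -/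
def coboundary : (V → ℝ) →ₗ[ℝ] G.Cochain1 where
  toFun g := ⟨fun e => g (G.terminal e) - g (G.origin e), by
    intro e
    simp [terminal, G.rev_rev]⟩
  map_add' := by
    intro f g
    ext e
    simp
    ring
  map_smul' := by
    intro r g
    ext e
    simp
    ring

@[simp] lemma coboundary_apply (g : V → ℝ) (e : E) :
    (G.coboundary g).1 e = g (G.terminal e) - g (G.origin e) := rfl

/-- The first cohomology group `H^1(Γ, ℝ) = C^1(Γ, ℝ) / Im d`. -/
abbrev Cohomology1 : Type _ := G.Cochain1 ⧸ LinearMap.range G.coboundary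

/-- The cohomology class of a `1`-cochain. -/
def cohomologyClass (ω : G.Cochain1) : G.Cohomology1 := Submodule.Quotient.mk ω

/-! ### Pairings -/

lemma edgeRelations_le_ker_pairing (ω : G.Cochain1) :
    G.edgeRelations ≤ LinearMap.ker (Finsupp.linearCombination ℝ ω.1) := by
  rw [edgeRelations, Submodule.span_le]
  rintro _ ⟨e, rfl⟩
  simp [ω.2 e]

/-- The pairing of a `1`-cochain with `1`-chains, `⟨ω, ∑ aₑ e⟩ = ∑ aₑ ω(e)`. -/
def chainPairing : G.Cochain1 →ₗ[ℝ] G.Chain1 →ₗ[ℝ] ℝ where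
  toFun ω := G.edgeRelations.liftQ (Finsupp.linearCombination ℝ ω.1)
    (G.edgeRelations_le_ker_pairing ω)
  map_add' := by
    intro ω η
    ext e
    simp
  map_smul' := by
    intro r ω
    ext e
    simp

lemma chainPairing_coboundary (g : V → ℝ) (z : G.Chain1) :
    G.chainPairing (G.coboundary g) z = Finsupp.linearCombination ℝ g (G.boundary z) := by
  have : G.chainPairing (G.coboundary g) = (Finsupp.linearCombination ℝ g).comp G.boundary := by
    ext e
    simp [chainPairing, boundary, preBoundary]
  rw [this]
  rfl

lemma range_coboundary_le_ker :
    LinearMap.range G.coboundary ≤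
      LinearMap.ker (((LinearMap.lcomp ℝ ℝ G.Homology1.subtype).comp G.chainPairing :
        G.Cochain1 →ₗ[ℝ] G.Homology1 →ₗ[ℝ] ℝ)) := by
  rintro _ ⟨g, rfl⟩
  rw [LinearMap.mem_ker]
  apply LinearMap.ext
  intro z
  have hz : G.boundary z.1 = 0 := z.2
  have h := G.chainPairing_coboundary g z.1
  rw [hz, map_zero] at h
  simpa using h

/-- The pairing between `H^1(Γ, ℝ)` and `H_1(Γ, ℝ)` induced by that of cochains and chains. -/
def pairing : G.Cohomology1 →ₗ[ℝ] G.Homology1 →ₗ[ℝ] ℝ :=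
  (LinearMap.range G.coboundary).liftQ
    ((LinearMap.lcomp ℝ ℝ G.Homology1.subtype).comp G.chainPairing) G.range_coboundary_le_ker

lemma pairing_class (ω : G.Cochain1) (h : G.Homology1) :
    G.pairing (G.cohomologyClass ω) h = G.chainPairing ω h.1 := rfl

/-! ### The tangent bundle and closed probability measures -/

/-- The identification `(e, 0) ∼ (-e, 0)` on `E × [0, ∞)`. -/
def tangentSetoid : Setoid (E × ℝ≥0) where
  r a b := a = b ∨ (a.2 = 0 ∧ b.2 = 0 ∧ b.1 = G.rev a.1)
  iseqv :=
    { refl := fun a => Or.inl rfl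
      symm := by
        rintro a b (rfl | ⟨h1, h2, h3⟩)
        · exact Or.inl rfl
        · exact Or.inr ⟨h2, h1, by rw [h3, G.rev_rev]⟩
      trans := by
        rintro a b c (rfl | ⟨h1, h2, h3⟩) (rfl | ⟨h4, h5, h6⟩)
        · exact Or.inl rfl
        · exact Or.inr ⟨h4, h5, h6⟩
        · exact Or.inr ⟨h1, h2, h3⟩
        · refine Or.inl (Prod.ext ?_ (h1.trans h5.symm))
          rw [h6, h3, G.rev_rev] }

/-- The tangent bundle `TΓ = E × [0, ∞) / ∼`. -/
def TangentBundle : Type _ := Quotient G.tangentSetoid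

/-- The point `(e, q)` of the tangent bundle. -/
def tangentPoint (e : E) (q : ℝ≥0) : G.TangentBundle := Quotient.mk G.tangentSetoid (e, q)

/-- The Borel sets of `TΓ`: those that intersect each fiber `{e} × [0, ∞)` in a Borel set. -/
instance : MeasurableSpace G.TangentBundle :=
  ⨅ e : E, MeasurableSpace.map (G.tangentPoint e) inferInstance

lemma measurableSet_tangentBundle_iff {F : Set G.TangentBundle} :
    MeasurableSet F ↔ ∀ e, MeasurableSet (G.tangentPoint e ⁻¹' F) :=
  MeasurableSpace.measurableSet_iInf

/-- The fiber over the edge `e`. -/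
def fiber (e : E) : Set G.TangentBundle := Set.range (G.tangentPoint e)

/-- The function `(e, q) ↦ F e q` on `TΓ`, for `F` compatible with the identification. -/
def liftFun (F : E → ℝ → ℝ) (hF : ∀ e, F (G.rev e) 0 = F e 0) : G.TangentBundle → ℝ :=
  Quotient.lift (fun x : E × ℝ≥0 => F x.1 x.2) (by
    rintro ⟨e, q⟩ ⟨f, r⟩ (h | ⟨h1, h2, h3⟩)
    · rw [h]
    · simp only at h1 h2 h3
      simp [h1, h2, h3, hF])

@[simp] lemma liftFun_tangentPoint (F : E → ℝ → ℝ) (hF : ∀ e, F (G.rev e) 0 = F e 0)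
    (e : E) (q : ℝ≥0) : G.liftFun F hF (G.tangentPoint e q) = F e q := rfl

/-- The function `(e, q) ↦ q`. -/
def speed : G.TangentBundle → ℝ := G.liftFun (fun _ q => q) fun _ => rfl

/-- The function `(e, q) ↦ ⟨ω, q e⟩`. -/
def cochainFun (ω : G.Cochain1) : G.TangentBundle → ℝ :=
  G.liftFun (fun e q => q * ω.1 e) fun e => by simp

/-- The set `𝕄` of closed probability measures: Borel probability measures on `TΓ` with finite
first moment such that `∫ df dμ = 0` for all `0`-cochains `f`. -/
def closedMeasures : Set (Measure G.TangentBundle) :=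
  {μ | IsProbabilityMeasure μ ∧ Integrable G.speed μ ∧
    ∀ f : V → ℝ, ∫ x, G.cochainFun (G.coboundary f) x ∂μ = 0}

/-- The rotation vector `ρ(μ) = ∑ₑ (∫ q dμ over the fiber of e) e`. -/
def rotation [Fintype E] (μ : Measure G.TangentBundle) : G.Chain1 :=
  ∑ e, (∫ x in G.fiber e, G.speed x ∂μ) • G.edgeChain e

end DirGraph

/-- A Hamiltonian on a graph: functions `H(e, ·)` labeled by the edges, with
`H(e, p) = H(-e, -p)`, each strictly convex, differentiable and superlinear at `±∞`. -/
structure Hamiltonian {V E : Type*} (G : DirGraph V E) where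
  val : E → ℝ → ℝ
  val_rev : ∀ e p, val e p = val (G.rev e) (-p)
  strictConvex : ∀ e, StrictConvexOn ℝ Set.univ (val e)
  differentiable : ∀ e, Differentiable ℝ (val e)
  superlinear_atTop : ∀ e, Tendsto (fun p => val e p / |p|) atTop atTop
  superlinear_atBot : ∀ e, Tendsto (fun p => val e p / |p|) atBot atTop

namespace Hamiltonian

variable {V E : Type*} {G : DirGraph V E} (H : Hamiltonian G)

lemma tendsto_cocompact (e : E) : Tendsto (H.val e) (cocompact ℝ) atTop := by
  rw [cocompact_eq_atBot_atTop, tendsto_sup]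
  constructor
  · refine ((H.superlinear_atBot e).atTop_mul_atTop₀ tendsto_abs_atBot_atTop).congr' ?_
    filter_upwards [eventually_lt_atBot 0] with p hp
    exact div_mul_cancel₀ _ (abs_pos.2 hp.ne).ne'
  · refine ((H.superlinear_atTop e).atTop_mul_atTop₀ tendsto_abs_atTop_atTop).congr' ?_
    filter_upwards [eventually_gt_atTop 0] with p hp
    exact div_mul_cancel₀ _ (abs_pos.2 hp.ne').ne'

lemma exists_minimizer (e : E) : ∃ p, ∀ q, H.val e p ≤ H.val e q :=
  (H.differentiable e).continuous.exists_forall_le (H.tendsto_cocompact e)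

/-- The (unique) minimizer `pₑ` of `H(e, ·)`. -/
def minimizer (e : E) : ℝ := (H.exists_minimizer e).choose

lemma minimizer_le (e : E) (q : ℝ) : H.val e (H.minimizer e) ≤ H.val e q :=
  (H.exists_minimizer e).choose_spec q

/-- `aₑ = min_p H(e, p)`. -/
def edgeMin (e : E) : ℝ := H.val e (H.minimizer e)

/-- `a₀ = max_e aₑ` (for a finite nonempty set of edges). -/
def a₀ : ℝ := ⨆ e, H.edgeMin e

/-- `σ(e, ·)`, the inverse function of the restriction of `H(e, ·)` to `[pₑ, ∞)`; it is meant to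
be evaluated on `[aₑ, ∞)`. -/
def sigma (e : E) (a : ℝ) : ℝ := Function.invFunOn (H.val e) (Set.Ici (H.minimizer e)) a

/-- The Lagrangian `L(e, q) = max_p (p q - H(e, p))`. -/
def lagrangian (e : E) (q : ℝ) : ℝ := ⨆ p : ℝ, (p * q - H.val e p)

lemma lagrangian_rev (e : E) (q : ℝ) : H.lagrangian (G.rev e) q = H.lagrangian e (-q) := by
  unfold lagrangian
  refine (Equiv.neg ℝ).iSup_congr fun p => ?_
  have := H.val_rev (G.rev e) p
  rw [G.rev_rev] at this
  simp [this]

/-- The Lagrangian as a function on the tangent bundle. -/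
def lagrangianFun : G.TangentBundle → ℝ :=
  G.liftFun H.lagrangian fun e => by simpa using H.lagrangian_rev e 0

/-- Mather's `β` function: `β(h)` is the minimum of `∫ L dμ` over the closed measures `μ` with
rotation vector `h`.  The Lagrangian is bounded below, so a measure for which it is not integrable
has action `+∞` and does not compete in the minimum. -/
def beta [Fintype E] (h : G.Homology1) : ℝ :=
  sInf {A : ℝ | ∃ μ ∈ G.closedMeasures, G.rotation μ = h.1 ∧ Integrable H.lagrangianFun μ ∧
    A = ∫ x, H.lagrangianFun x ∂μ}

/-- Mather's `α` function, the convex conjugate of `β`: `α(c) = max_h (⟨c, h⟩ - β(h))`. -/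
def alpha [Fintype E] (c : G.Cohomology1) : ℝ :=
  ⨆ h : G.Homology1, (G.pairing c h - H.beta h)

/-! ### Weak KAM theory -/

/-- The modified Hamiltonian `H^ω(e, p) = H(e, p + ⟨ω, e⟩)`. -/
def modified (ω : G.Cochain1) (e : E) (p : ℝ) : ℝ := H.val e (p + ω.1 e)

/-- `σ^ω(e, a) = σ(e, a) - ⟨ω, e⟩`. -/
def modifiedSigma (ω : G.Cochain1) (e : E) (a : ℝ) : ℝ := H.sigma e a - ω.1 e

/-- The intrinsic length `σ^ω(ξ, a)` of a path `ξ`. -/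
def intrinsicLength (ω : G.Cochain1) (l : List E) (a : ℝ) : ℝ :=
  (l.map fun e => H.modifiedSigma ω e a).sum

/-- `u` is a subsolution of the discrete Hamilton-Jacobi equation: for every vertex `x`, the
maximum of `H^ω(e, ⟨du, e⟩)` over the edges `e` ending at `x` is at most `a`. -/
def IsSubsolution (ω : G.Cochain1) (a : ℝ) (u : V → ℝ) : Prop :=
  ∀ x : V, ∀ e : E, G.terminal e = x → H.modified ω e ((G.coboundary u).1 e) ≤ a

/-- The critical value of `H^ω`: the minimum of those `a` for which the Hamilton-Jacobi equation
at level `a` admits subsolutions. -/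
def criticalValue (ω : G.Cochain1) : ℝ := sInf {a : ℝ | ∃ u : V → ℝ, H.IsSubsolution ω a u}

lemma isSubsolution_add_coboundary {ω : G.Cochain1} {a : ℝ} {u : V → ℝ} (w : V → ℝ)
    (h : H.IsSubsolution ω a u) : H.IsSubsolution (ω + G.coboundary w) a (u - w) := by
  intro x e he
  have := h x e he
  simp only [modified, DirGraph.coboundary_apply, Submodule.coe_add, Pi.add_apply,
    Pi.sub_apply] at this ⊢
  convert this using 2
  ring

lemma criticalValue_add_coboundary (ω : G.Cochain1) (w : V → ℝ) :
    H.criticalValue (ω + G.coboundary w) = H.criticalValue ω := by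
  unfold criticalValue
  congr 1
  ext a
  constructor
  · rintro ⟨u, hu⟩
    have := H.isSubsolution_add_coboundary (-w) hu
    rw [map_neg, add_neg_cancel_right] at this
    exact ⟨_, this⟩
  · rintro ⟨u, hu⟩
    exact ⟨_, H.isSubsolution_add_coboundary w hu⟩

/-- The critical value as a function of the cohomology class. -/
def alphaTilde (c : G.Cohomology1) : ℝ :=
  Quotient.liftOn' c H.criticalValue (by
    intro ω η h
    rw [Submodule.quotientRel_def] at h
    obtain ⟨w, hw⟩ := h
    rw [← H.criticalValue_add_coboundary η w, hw, add_sub_cancel])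

@[simp] lemma alphaTilde_class (ω : G.Cochain1) :
    H.alphaTilde (G.cohomologyClass ω) = H.criticalValue ω := rfl

/-- The edges belonging to some cycle whose intrinsic length at the critical level vanishes. -/
def cochainAubrySet (ω : G.Cochain1) : Set E :=
  {e | ∃ l, G.IsCycle l ∧ e ∈ l ∧ H.intrinsicLength ω l (H.criticalValue ω) = 0}

lemma sum_coboundary_of_concatenated (w : V → ℝ) :
    ∀ (l : List E) (x y : V), G.Concatenated x l y →
      (l.map fun e => (G.coboundary w).1 e).sum = w y - w x := by
  intro l
  induction l with
  | nil =>
    intro x y h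
    have : x = y := h
    simp [this]
  | cons e l ih =>
    rintro x y ⟨rfl, h⟩
    rw [List.map_cons, List.sum_cons, ih _ _ h]
    simp

lemma sum_coboundary_of_isCycle (w : V → ℝ) {l : List E} (h : G.IsCycle l) :
    (l.map fun e => (G.coboundary w).1 e).sum = 0 := by
  obtain ⟨x, -, hx⟩ := h
  rw [sum_coboundary_of_concatenated w l x x hx, sub_self]

lemma intrinsicLength_add_coboundary (ω : G.Cochain1) (w : V → ℝ) {l : List E}
    (h : G.IsCycle l) (a : ℝ) :
    H.intrinsicLength (ω + G.coboundary w) l a = H.intrinsicLength ω l a := by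
  have h0 := sum_coboundary_of_isCycle w h
  unfold intrinsicLength
  rw [← add_zero (List.sum _), ← h0, ← List.sum_map_add]
  congr 1
  refine List.map_congr_left fun e _ => ?_
  simp only [modifiedSigma, Submodule.coe_add, Pi.add_apply]
  ring

lemma cochainAubrySet_add_coboundary (ω : G.Cochain1) (w : V → ℝ) :
    H.cochainAubrySet (ω + G.coboundary w) = H.cochainAubrySet ω := by
  ext e
  simp only [cochainAubrySet, Set.mem_ofPred_eq, criticalValue_add_coboundary]
  refine exists_congr fun l => ⟨fun ⟨h1, h2, h3⟩ => ⟨h1, h2, ?_⟩, fun ⟨h1, h2, h3⟩ => ⟨h1, h2, ?_⟩⟩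
  · rwa [H.intrinsicLength_add_coboundary ω w h1] at h3
  · rwa [H.intrinsicLength_add_coboundary ω w h1]

/-- The Aubry set `𝒜_c`. -/
def aubrySet (c : G.Cohomology1) : Set E :=
  Quotient.liftOn' c H.cochainAubrySet (by
    intro ω η h
    rw [Submodule.quotientRel_def] at h
    obtain ⟨w, hw⟩ := h
    rw [← H.cochainAubrySet_add_coboundary η w, hw, add_sub_cancel])

@[simp] lemma aubrySet_class (ω : G.Cochain1) :
    H.aubrySet (G.cohomologyClass ω) = H.cochainAubrySet ω := rfl

lemma edgeMin_le_of_isSubsolution {ω : G.Cochain1} {a : ℝ} {u : V → ℝ}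
    (h : H.IsSubsolution ω a u) (e : E) : H.edgeMin e ≤ a :=
  (H.minimizer_le e _).trans (h _ e rfl)

/-- The set of levels admitting subsolutions has a minimum. -/
lemma exists_critical_subsolution [Fintype E] [Nonempty E] (ω : G.Cochain1) :
    ∃ u : V → ℝ, H.IsSubsolution ω (H.criticalValue ω) u := by
  classical
  let F : (E → ℝ) → ℝ := fun η =>
    Finset.univ.sup' Finset.univ_nonempty fun e => H.val e (η e + ω.1 e)
  have hF : Continuous F := by
    refine Continuous.finset_sup'_apply _ fun e _ => ?_
    exact (H.differentiable e).continuous.comp (by fun_prop)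
  let D : Submodule ℝ (E → ℝ) := LinearMap.range (G.Cochain1.subtype.comp G.coboundary)
  let K : ℝ → Set (E → ℝ) := fun a => {η | η ∈ D ∧ ∀ e, H.val e (η e + ω.1 e) ≤ a}
  have hK : IsCompact (K (F 0)) := by
    have hc : ∀ e, ∃ t : Set ℝ, IsCompact t ∧ ∀ p, H.val e (p + ω.1 e) ≤ F 0 → p ∈ t := by
      intro e
      have h1 := (H.tendsto_cocompact e).eventually_gt_atTop (F 0)
      obtain ⟨t, ht, hts⟩ := mem_cocompact.1 h1
      refine ⟨(fun p => p - ω.1 e) '' t, ht.image (by fun_prop), fun p hp => ?_⟩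
      refine ⟨p + ω.1 e, ?_, by ring⟩
      by_contra hn
      exact absurd (hts hn) (not_lt.2 hp)
    choose t ht hts using hc
    refine (isCompact_univ_pi ht).of_isClosed_subset ?_ ?_
    · have h1 : IsClosed (D : Set (E → ℝ)) := D.closed_of_finiteDimensional
      have h2 : IsClosed {η : E → ℝ | ∀ e, H.val e (η e + ω.1 e) ≤ F 0} := by
        rw [Set.ofPred_forall]
        refine isClosed_iInter fun e => isClosed_le ?_ continuous_const
        exact (H.differentiable e).continuous.comp (by fun_prop)
      exact h1.inter h2
    · intro η hη e _
      exact hts e _ (hη.2 e)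
  have h0 : (0 : E → ℝ) ∈ K (F 0) := by
    refine ⟨D.zero_mem, fun e => ?_⟩
    exact Finset.le_sup' (fun e => H.val e ((0 : E → ℝ) e + ω.1 e)) (Finset.mem_univ e)
  obtain ⟨η, hη, hmin⟩ := hK.exists_isMinOn ⟨0, h0⟩ hF.continuousOn
  obtain ⟨u, hu⟩ := hη.1
  have hu' : ∀ e, (G.coboundary u).1 e = η e := fun e => by rw [← hu]; rfl
  have hsub : H.IsSubsolution ω (F η) u := by
    intro x e _
    rw [modified, hu']
    exact Finset.le_sup' (fun e => H.val e (η e + ω.1 e)) (Finset.mem_univ e)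
  have hleast : IsLeast {a : ℝ | ∃ u : V → ℝ, H.IsSubsolution ω a u} (F η) := by
    refine ⟨⟨u, hsub⟩, ?_⟩
    rintro a ⟨v, hv⟩
    rcases le_or_gt (F 0) a with ha | ha
    · exact (hmin h0).trans ha
    · have hvK : (G.coboundary v).1 ∈ K (F 0) :=
        ⟨⟨v, rfl⟩, fun e => (hv _ e rfl).trans ha.le⟩
      refine (hmin hvK).trans ?_
      exact Finset.sup'_le _ _ fun e _ => hv _ e rfl
  refine ⟨u, ?_⟩
  rw [criticalValue, hleast.csInf_eq]
  exact hsub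

/-- The function `𝒬_c` on the Aubry set, `𝒬_c(e) = ∂/∂p H^ω(e, ⟨du, e⟩)`, for some representative
`ω` of `c` and some subsolution `u` of the critical equation for `H^ω`.  By `speedQ_eq` the value
is the same for all choices of `ω` and `u`. -/
def speedQ [Fintype E] [Nonempty E] (c : G.Cohomology1) (e : H.aubrySet c) : ℝ :=
  deriv (H.modified (Quotient.out c) e)
    ((G.coboundary (H.exists_critical_subsolution (Quotient.out c)).choose).1 e)

lemma strictMonoOn (e : E) : StrictMonoOn (H.val e) (Set.Ici (H.minimizer e)) := by
  intro x hx y hy hxy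
  have hx' : H.minimizer e ≤ x := hx
  rcases hx'.eq_or_lt with rfl | hlt
  · refine lt_of_le_of_ne (H.minimizer_le e y) fun heq => ?_
    have := (H.strictConvex e).2 (Set.mem_univ (H.minimizer e)) (Set.mem_univ y) hxy.ne
      (by norm_num : (0 : ℝ) < 1 / 2) (by norm_num : (0 : ℝ) < 1 / 2) (by norm_num)
    have h2 := H.minimizer_le e ((1 / 2 : ℝ) • H.minimizer e + (1 / 2 : ℝ) • y)
    simp only [smul_eq_mul] at this h2
    linarith
  · have h1 := (H.strictConvex e).slope_strict_mono_adjacent (Set.mem_univ (H.minimizer e))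
      (Set.mem_univ y) hlt hxy
    have h2 : 0 ≤ (H.val e x - H.val e (H.minimizer e)) / (x - H.minimizer e) :=
      div_nonneg (sub_nonneg.2 (H.minimizer_le e x)) (sub_nonneg.2 hlt.le)
    have h3 := h2.trans_lt h1
    rw [lt_div_iff₀ (sub_pos.2 hxy), zero_mul] at h3
    linarith

lemma exists_ge_val_eq (e : E) {a : ℝ} (ha : H.edgeMin e ≤ a) :
    ∃ p ∈ Set.Ici (H.minimizer e), H.val e p = a := by
  have ht : Tendsto (H.val e) atTop atTop :=
    (H.tendsto_cocompact e).mono_left (by rw [cocompact_eq_atBot_atTop]; exact le_sup_right)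
  obtain ⟨r, hr1, hr2⟩ :=
    ((ht.eventually_ge_atTop a).and (eventually_ge_atTop (H.minimizer e))).exists
  obtain ⟨p, hp, hpa⟩ := intermediate_value_Icc hr2 (H.differentiable e).continuous.continuousOn
    ⟨ha, hr1⟩
  exact ⟨p, hp.1, hpa⟩

lemma minimizer_le_sigma (e : E) {a : ℝ} (ha : H.edgeMin e ≤ a) :
    H.minimizer e ≤ H.sigma e a :=
  Function.invFunOn_mem (H.exists_ge_val_eq e ha)

lemma val_sigma (e : E) {a : ℝ} (ha : H.edgeMin e ≤ a) : H.val e (H.sigma e a) = a :=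
  Function.invFunOn_eq (H.exists_ge_val_eq e ha)

lemma le_sigma_of_val_le {e : E} {p a : ℝ} (h : H.val e p ≤ a) : p ≤ H.sigma e a := by
  have ha : H.edgeMin e ≤ a := (H.minimizer_le e p).trans h
  by_contra! hlt
  have h1 := H.minimizer_le_sigma e ha
  have h2 := H.strictMonoOn e h1 (h1.trans hlt.le) hlt
  rw [H.val_sigma e ha] at h2
  linarith

/-- The differentials of the critical subsolutions coincide on the Aubry set. -/
lemma coboundary_eq_of_mem_aubrySet {ω : G.Cochain1} {u : V → ℝ}
    (hu : H.IsSubsolution ω (H.criticalValue ω) u) {e : E} (he : e ∈ H.cochainAubrySet ω) :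
    (G.coboundary u).1 e = H.modifiedSigma ω e (H.criticalValue ω) := by
  obtain ⟨l, hl, hel, h0⟩ := he
  have h1 := sum_coboundary_of_isCycle u hl
  have hle : ∀ f, (G.coboundary u).1 f ≤ H.modifiedSigma ω f (H.criticalValue ω) := by
    intro f
    have := H.le_sigma_of_val_le (hu _ f rfl)
    rw [modifiedSigma]
    linarith
  refine le_antisymm (hle e) ?_
  by_contra! hlt
  have := List.sum_lt_sum (l := l) (fun f => (G.coboundary u).1 f)
    (fun f => H.modifiedSigma ω f (H.criticalValue ω)) (fun f _ => hle f) ⟨e, hel, hlt⟩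
  rw [h1] at this
  exact this.ne' h0

/-- The value `𝒬_c(e)` does not depend on the representative nor on the critical subsolution. -/
lemma speedQ_eq [Fintype E] [Nonempty E] (ω : G.Cochain1) {u : V → ℝ}
    (hu : H.IsSubsolution ω (H.criticalValue ω) u) (e : H.aubrySet (G.cohomologyClass ω)) :
    H.speedQ (G.cohomologyClass ω) e = deriv (H.modified ω e) ((G.coboundary u).1 e) := by
  have key : ∀ (η : G.Cochain1) (v : V → ℝ), H.IsSubsolution η (H.criticalValue η) v →
      G.cohomologyClass η = G.cohomologyClass ω →
      deriv (H.modified η e) ((G.coboundary v).1 e) =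
        deriv (H.val e) (H.sigma e (H.criticalValue ω)) := by
    intro η v hv hη
    have he : (e : E) ∈ H.cochainAubrySet η := by
      rw [← aubrySet_class, hη]
      exact e.2
    rw [H.coboundary_eq_of_mem_aubrySet hv he]
    have hcrit : H.criticalValue η = H.criticalValue ω := by
      rw [← alphaTilde_class, hη, alphaTilde_class]
    have : H.modified η e = fun p => H.val e (p + η.1 e) := rfl
    rw [this, deriv_comp_add_const, modifiedSigma, sub_add_cancel, hcrit]
  rw [key ω u hu rfl, speedQ]
  exact key _ _ (H.exists_critical_subsolution _).choose_spec (Quotient.out_eq _)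

end Hamiltonian

end AubryMather

end

/-!
The theorem reduces to the identity `α = α̃` between Mather's function and the critical value.

*The identity.* Let `u` be a critical subsolution for `ω`. By the Fenchel inequality,
`⟨ω + du, q e⟩ ≤ L(e, q) + α̃`; integrating against a closed measure with rotation vector `h` gives
`⟨c, h⟩ - β(h) ≤ α̃(c)` (`alpha_term_le`); here one needs that every homology class is the rotation
vector of some measure of finite action (`exists_finite_action`). Conversely `du` minimizes the
convex function `max_e H(e, ω(e) + ·)` on the exact cochains, so no exact cochain `dw` is a
direction of strict decrease for all edges `e` at which this maximum is attained
(`not_exists_descent`). By Hahn-Banach separation a convex combination of the functionals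
`w ↦ ∂ₚH(e, ω(e) + du(e)) ⟨dw, e⟩` over those edges vanishes (`exists_critical_weights`). This is
the closedness of the measure which puts the corresponding weights on the speeds
`q = ∂ₚH(e, ω(e) + du(e))`, and equality in the Fenchel inequality shows that it realizes the
value `α̃`.

*The minimum.* Every level of a subsolution is at least `a₀`, and the level `a₀` is attained for
the cochain `e ↦ pₑ`, with the constant subsolution. If `α̃(c) = a₀` and `aₑ = a₀`, then
`σ(e, a₀) = pₑ` and `σ(-e, a₀) = -pₑ`, so that the cycle `(e, -e)` has length zero and
`𝒬_c(e) = ∂ₚH(e, pₑ) = 0`. In the other direction, `𝒬_c(e) = 0` forces `σ(e, α̃(c)) = pₑ`,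
that is, `α̃(c) = aₑ ≤ a₀`.
-/

noncomputable section

namespace AubryMather

namespace DirGraph

variable {V E : Type*} (G : DirGraph V E)

/-! ### Measurability and integration on the tangent bundle -/

lemma tangentPoint_eq_iff {e f : E} {q r : ℝ≥0} :
    G.tangentPoint e q = G.tangentPoint f r ↔
      (e, q) = (f, r) ∨ (q = 0 ∧ r = 0 ∧ f = G.rev e) :=
  ⟨fun h => Quotient.exact h, fun h => Quotient.sound h⟩

lemma exists_tangentPoint_eq (x : G.TangentBundle) : ∃ e q, x = G.tangentPoint e q := by
  obtain ⟨⟨e, q⟩, rfl⟩ := Quotient.exists_rep x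
  exact ⟨e, q, rfl⟩

lemma eq_of_tangentPoint_eq {e f : E} {q r : ℝ≥0} (h : G.tangentPoint e q = G.tangentPoint f r) :
    q = r := by
  rcases G.tangentPoint_eq_iff.1 h with h | ⟨h1, h2, -⟩
  · exact (Prod.ext_iff.1 h).2
  · rw [h1, h2]

instance : MeasurableSingletonClass G.TangentBundle where
  measurableSet_singleton x := by
    rw [measurableSet_tangentBundle_iff]
    intro e
    refine Set.Subsingleton.measurableSet fun q hq r hr => ?_
    exact G.eq_of_tangentPoint_eq
      ((Set.mem_singleton_iff.1 hq).trans (Set.mem_singleton_iff.1 hr).symm)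

lemma measurableSet_fiber (e : E) : MeasurableSet (G.fiber e) := by
  rw [measurableSet_tangentBundle_iff]
  intro f
  by_cases hfe : f = e
  · subst hfe
    have : G.tangentPoint f ⁻¹' G.fiber f = Set.univ :=
      Set.eq_univ_of_forall fun q => ⟨q, rfl⟩
    rw [this]
    exact MeasurableSet.univ
  · refine Set.Subsingleton.measurableSet fun q hq r hr => ?_
    have key : ∀ s, G.tangentPoint f s ∈ G.fiber e → s = 0 := by
      rintro s ⟨t, ht⟩
      rcases G.tangentPoint_eq_iff.1 ht with h | ⟨h1, h2, -⟩
      · exact absurd (Prod.ext_iff.1 h).1.symm hfe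
      · exact h2
    rw [key q hq, key r hr]

@[simp] lemma speed_tangentPoint (e : E) (q : ℝ≥0) : G.speed (G.tangentPoint e q) = q := rfl

@[simp] lemma cochainFun_tangentPoint (ω : G.Cochain1) (e : E) (q : ℝ≥0) :
    G.cochainFun ω (G.tangentPoint e q) = q * ω.1 e := rfl

/-- The fibers overlap only in points of speed zero, so a point `(e, q)` contributes to the
integral of the speed over the fiber of `e` only. -/
lemma sum_indicator_fiber_smul [Fintype E] {M : Type*} [AddCommGroup M] [Module ℝ M]
    (w : E → M) (e : E) (q : ℝ≥0) :
    ∑ f, (G.fiber f).indicator G.speed (G.tangentPoint e q) • w f = (q : ℝ) • w e := by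
  classical
  rw [Finset.sum_eq_single e]
  · have hm : G.tangentPoint e q ∈ G.fiber e := ⟨q, rfl⟩
    rw [Set.indicator_of_mem hm, speed_tangentPoint]
  · intro f _ hf
    by_cases hm : G.tangentPoint e q ∈ G.fiber f
    · obtain ⟨r, hr⟩ := hm
      rcases G.tangentPoint_eq_iff.1 hr with h | ⟨-, h2, -⟩
      · exact absurd (Prod.ext_iff.1 h).1 hf
      · simp [Set.indicator_apply, h2]
    · rw [Set.indicator_of_notMem hm, zero_smul]
  · simp

lemma cochainFun_eq_sum [Fintype E] (ω : G.Cochain1) (x : G.TangentBundle) :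
    G.cochainFun ω x = ∑ f, (G.fiber f).indicator G.speed x * ω.1 f := by
  obtain ⟨e, q, rfl⟩ := G.exists_tangentPoint_eq x
  exact (G.sum_indicator_fiber_smul ω.1 e q).symm

lemma integrable_cochainFun [Fintype E] {μ : Measure G.TangentBundle}
    (hμ : Integrable G.speed μ) (ω : G.Cochain1) : Integrable (G.cochainFun ω) μ := by
  have : G.cochainFun ω = fun x => ∑ f, (G.fiber f).indicator G.speed x * ω.1 f :=
    funext (G.cochainFun_eq_sum ω)
  rw [this]
  exact integrable_finsetSum _ fun f _ => (hμ.indicator (G.measurableSet_fiber f)).mul_const _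

lemma chainPairing_edgeChain (ω : G.Cochain1) (e : E) :
    G.chainPairing ω (G.edgeChain e) = ω.1 e := by
  simp [chainPairing, edgeChain]

lemma edgeChain_rev (e : E) : G.edgeChain (G.rev e) = - G.edgeChain e := by
  rw [eq_neg_iff_add_eq_zero, edgeChain, edgeChain, ← map_add]
  exact (Submodule.Quotient.mk_eq_zero _).2 (Submodule.subset_span ⟨e, rfl⟩)

lemma chainPairing_rotation [Fintype E] {μ : Measure G.TangentBundle}
    (hμ : Integrable G.speed μ) (ω : G.Cochain1) :
    G.chainPairing ω (G.rotation μ) = ∫ x, G.cochainFun ω x ∂μ := by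
  simp_rw [G.cochainFun_eq_sum ω]
  rw [integral_finsetSum _ fun f _ => (hμ.indicator (G.measurableSet_fiber f)).mul_const _]
  rw [rotation, map_sum]
  refine Finset.sum_congr rfl fun f _ => ?_
  rw [map_smul, chainPairing_edgeChain, integral_mul_const,
    integral_indicator (G.measurableSet_fiber f), smul_eq_mul]

lemma boundary_eq_zero_of_forall_chainPairing {z : G.Chain1}
    (hz : ∀ f : V → ℝ, G.chainPairing (G.coboundary f) z = 0) : G.boundary z = 0 := by
  classical
  ext v
  have := hz (Pi.single v 1)
  rw [chainPairing_coboundary, Finsupp.linearCombination_apply, Finsupp.sum] at this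
  simpa [Pi.single_apply] using this

lemma boundary_rotation [Fintype E] {μ : Measure G.TangentBundle} (hμ : μ ∈ G.closedMeasures) :
    G.boundary (G.rotation μ) = 0 :=
  G.boundary_eq_zero_of_forall_chainPairing fun f => by
    rw [G.chainPairing_rotation hμ.2.1, hμ.2.2 f]

/-! ### Atomic measures -/

/-- The point of `TΓ` that represents the edge `e` run at the signed speed `v`: when `v < 0` this
is the reversed edge run at the speed `-v`. -/
def signedPoint (e : E) (v : ℝ) : G.TangentBundle :=
  G.tangentPoint (if 0 ≤ v then e else G.rev e) (Real.nnabs v)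

lemma liftFun_signedPoint (F : E → ℝ → ℝ) (hF : ∀ e, F (G.rev e) 0 = F e 0)
    (hF' : ∀ e q, F (G.rev e) q = F e (-q)) (e : E) (v : ℝ) :
    G.liftFun F hF (G.signedPoint e v) = F e v := by
  rw [signedPoint, liftFun_tangentPoint]
  by_cases hv : 0 ≤ v
  · simp [hv]
  · simp [hv, abs_of_neg (not_le.1 hv), hF']

lemma cochainFun_signedPoint (ω : G.Cochain1) (e : E) (v : ℝ) :
    G.cochainFun ω (G.signedPoint e v) = v * ω.1 e :=
  G.liftFun_signedPoint _ _ (fun e q => by rw [ω.2 e]; ring) e v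

lemma sum_indicator_fiber_signedPoint [Fintype E] (e : E) (v : ℝ) :
    ∑ f, (G.fiber f).indicator G.speed (G.signedPoint e v) • G.edgeChain f =
      v • G.edgeChain e := by
  rw [signedPoint, sum_indicator_fiber_smul]
  by_cases hv : 0 ≤ v
  · simp [hv]
  · simp [hv, abs_of_neg (not_le.1 hv), edgeChain_rev]

variable {ι : Type*} [Fintype ι]

/-- The measure with the weights `l i` at the points that represent the edges `e i` run at the
signed speeds `v i`. -/
def atomicMeasure (l : ι → ℝ≥0) (e : ι → E) (v : ι → ℝ) : Measure G.TangentBundle :=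
  ∑ i, l i • Measure.dirac (G.signedPoint (e i) (v i))

variable (l : ι → ℝ≥0) (e : ι → E) (v : ι → ℝ)

lemma integrable_atomicMeasure (F : G.TangentBundle → ℝ) :
    Integrable F (G.atomicMeasure l e v) := by
  rw [atomicMeasure, integrable_finsetSum_measure]
  intro i _
  exact (integrable_dirac (by simp)).smul_measure_nnreal

lemma integral_atomicMeasure (F : G.TangentBundle → ℝ) :
    ∫ x, F x ∂(G.atomicMeasure l e v) = ∑ i, (l i : ℝ) * F (G.signedPoint (e i) (v i)) := by
  rw [atomicMeasure, integral_finsetSum_measure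
    fun i _ => (integrable_dirac (by simp)).smul_measure_nnreal]
  refine Finset.sum_congr rfl fun i _ => ?_
  rw [integral_smul_nnreal_measure, integral_dirac]
  rfl

lemma rotation_atomicMeasure [Fintype E] :
    G.rotation (G.atomicMeasure l e v) = ∑ i, ((l i : ℝ) * v i) • G.edgeChain (e i) := by
  simp_rw [rotation, ← integral_indicator (G.measurableSet_fiber _), integral_atomicMeasure,
    Finset.sum_smul]
  rw [Finset.sum_comm]
  refine Finset.sum_congr rfl fun i _ => ?_
  simp_rw [mul_smul]
  rw [← Finset.smul_sum, sum_indicator_fiber_signedPoint]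

lemma atomicMeasure_mem_closedMeasures (hl : ∑ i, l i = 1)
    (hc : ∀ f : V → ℝ, ∑ i, (l i : ℝ) * (v i * (G.coboundary f).1 (e i)) = 0) :
    G.atomicMeasure l e v ∈ G.closedMeasures := by
  refine ⟨⟨?_⟩, G.integrable_atomicMeasure l e v _, fun f => ?_⟩
  · rw [atomicMeasure, Measure.finsetSum_apply, ← ENNReal.coe_one, ← hl, ENNReal.ofNNReal_finsetSum]
    refine Finset.sum_congr rfl fun i _ => ?_
    rw [Measure.smul_apply, measure_univ, ENNReal.smul_def, smul_eq_mul, mul_one]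
  · rw [integral_atomicMeasure]
    simpa only [cochainFun_signedPoint] using hc f

/-- Every homology class is the rotation vector of an atomic closed measure. -/
lemma exists_atomicMeasure_rotation_eq [Fintype E] [Nonempty E] (h : G.Homology1) :
    ∃ (l : E → ℝ≥0) (v : E → ℝ), G.atomicMeasure l id v ∈ G.closedMeasures ∧
      G.rotation (G.atomicMeasure l id v) = h.1 := by
  obtain ⟨z, hz⟩ := G.edgeRelations.mkQ_surjective h.1
  have hN : (Fintype.card E : ℝ) ≠ 0 := by exact_mod_cast Fintype.card_ne_zero
  have hzs : ∑ e, z e • G.edgeChain e = h.1 := by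
    rw [← hz]
    conv_rhs => rw [← Finsupp.univ_sum_single z]
    rw [map_sum]
    refine Finset.sum_congr rfl fun e _ => ?_
    rw [edgeChain, ← map_smul, Finsupp.smul_single, smul_eq_mul, mul_one]
  have hmul : ∀ e, (((Fintype.card E : ℝ≥0)⁻¹ : ℝ≥0) : ℝ) * (Fintype.card E * z e) = z e := by
    intro e
    rw [NNReal.coe_inv, NNReal.coe_natCast, inv_mul_cancel_left₀ hN]
  -- Uniform weights; the speeds are scaled by `card E` to compensate.
  refine ⟨fun _ => (Fintype.card E : ℝ≥0)⁻¹, fun e => Fintype.card E * z e, ?_, ?_⟩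
  · refine G.atomicMeasure_mem_closedMeasures _ _ _ ?_ fun f => ?_
    · have hN' : (Fintype.card E : ℝ≥0) ≠ 0 := by exact_mod_cast Fintype.card_ne_zero
      rw [Finset.sum_const, Finset.card_univ, nsmul_eq_mul, mul_inv_cancel₀ hN']
    · have h0 := G.chainPairing_coboundary f h.1
      rw [show G.boundary h.1 = 0 from h.2, map_zero, ← hzs, map_sum] at h0
      rw [← h0]
      refine Finset.sum_congr rfl fun e _ => ?_
      rw [map_smul, chainPairing_edgeChain, smul_eq_mul, ← mul_assoc, hmul, id]
  · rw [rotation_atomicMeasure, ← hzs]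
    simp_rw [hmul, id]

end DirGraph

namespace Hamiltonian

variable {V E : Type*} {G : DirGraph V E} (H : Hamiltonian G)

/-! ### The Lagrangian -/

lemma bddAbove_lagrangian (e : E) (q : ℝ) :
    BddAbove (Set.range fun p : ℝ => p * q - H.val e p) := by
  have hcont : Continuous fun p => H.val e p - p * q :=
    (H.differentiable e).continuous.sub (by fun_prop)
  have key : ∀ l : Filter ℝ, Tendsto (fun p => H.val e p / |p|) l atTop →
      Tendsto (fun p : ℝ => |p|) l atTop → Tendsto (fun p => H.val e p - p * q) l atTop := by
    intro l h1 h2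
    refine tendsto_atTop_mono' l ?_ h2
    filter_upwards [h1.eventually_ge_atTop (|q| + 1), h2.eventually_gt_atTop 0] with p hp hp0
    rw [le_div_iff₀ hp0] at hp
    have : p * q ≤ |q| * |p| := by
      rw [mul_comm, ← abs_mul]
      exact le_abs_self _
    linarith
  have htend : Tendsto (fun p => H.val e p - p * q) (cocompact ℝ) atTop := by
    rw [cocompact_eq_atBot_atTop, tendsto_sup]
    exact ⟨key _ (H.superlinear_atBot e) tendsto_abs_atBot_atTop,
      key _ (H.superlinear_atTop e) tendsto_abs_atTop_atTop⟩
  obtain ⟨p₀, hp₀⟩ := hcont.exists_forall_le htend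
  refine ⟨p₀ * q - H.val e p₀, ?_⟩
  rintro _ ⟨p, rfl⟩
  have := hp₀ p
  simp only
  linarith

lemma fenchel_inequality (e : E) (p q : ℝ) : p * q ≤ H.lagrangian e q + H.val e p := by
  have := le_ciSup (H.bddAbove_lagrangian e q) p
  rw [lagrangian]
  linarith

lemma val_add_deriv_mul_le (e : E) (p r : ℝ) :
    H.val e p + deriv (H.val e) p * (r - p) ≤ H.val e r := by
  have hd := (H.differentiable e p).hasDerivAt
  rcases lt_trichotomy p r with h | rfl | h
  · have := (H.strictConvex e).convexOn.le_slope_of_hasDerivAt (Set.mem_univ p) (Set.mem_univ r)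
      h hd
    rw [slope_def_field, le_div_iff₀ (sub_pos.2 h)] at this
    linarith
  · simp
  · have := (H.strictConvex e).convexOn.slope_le_of_hasDerivAt (Set.mem_univ r) (Set.mem_univ p)
      h hd
    rw [slope_def_field, div_le_iff₀ (sub_pos.2 h)] at this
    linarith

lemma lagrangian_deriv (e : E) (p : ℝ) :
    H.lagrangian e (deriv (H.val e) p) = p * deriv (H.val e) p - H.val e p := by
  refine le_antisymm (ciSup_le fun r => ?_) (le_ciSup (H.bddAbove_lagrangian e _) p)
  have := H.val_add_deriv_mul_le e p r
  linarith

lemma lagrangianFun_signedPoint (e : E) (v : ℝ) :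
    H.lagrangianFun (G.signedPoint e v) = H.lagrangian e v :=
  G.liftFun_signedPoint _ _ H.lagrangian_rev e v

/-! ### The critical value as a minimax -/

lemma criticalValue_le [Nonempty E] {ω : G.Cochain1} {a : ℝ} {u : V → ℝ}
    (hu : H.IsSubsolution ω a u) : H.criticalValue ω ≤ a := by
  obtain ⟨e⟩ := ‹Nonempty E›
  refine csInf_le ⟨H.edgeMin e, ?_⟩ ⟨u, hu⟩
  rintro b ⟨v, hv⟩
  exact H.edgeMin_le_of_isSubsolution hv e

/-- A critical subsolution cannot be perturbed so as to decrease `H^ω(e, ·)` to first order on all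
edges where the critical value is attained. -/
lemma not_exists_descent [Fintype E] [Nonempty E] {ω : G.Cochain1} {u : V → ℝ}
    (hu : H.IsSubsolution ω (H.criticalValue ω) u) (w : V → ℝ) :
    ∃ e, H.val e ((G.coboundary u).1 e + ω.1 e) = H.criticalValue ω ∧
      0 ≤ deriv (H.val e) ((G.coboundary u).1 e + ω.1 e) * (G.coboundary w).1 e := by
  by_contra! hw
  have key : ∀ e, ∀ᶠ t in nhdsWithin (0 : ℝ) (Set.Ioi 0),
      H.val e ((G.coboundary u).1 e + ω.1 e + t * (G.coboundary w).1 e) < H.criticalValue ω := by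
    intro e
    set p := (G.coboundary u).1 e + ω.1 e with hp
    set d := (G.coboundary w).1 e with hd
    have hle : H.val e p ≤ H.criticalValue ω := hu _ e rfl
    rcases hle.lt_or_eq with hlt | heq
    -- Below the critical value continuity suffices; at it, the derivative in `t` is negative.
    · have hcont : Continuous fun t : ℝ => H.val e (p + t * d) :=
        (H.differentiable e).continuous.comp (by fun_prop)
      have h0 : H.val e (p + 0 * d) < H.criticalValue ω := by simpa using hlt
      exact (hcont.continuousAt.eventually_lt_const h0).filter_mono nhdsWithin_le_nhds
    · have hder : HasDerivAt (fun t : ℝ => H.val e (p + t * d)) (deriv (H.val e) p * d) 0 := by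
        have h1 : HasDerivAt (fun t : ℝ => p + t * d) d 0 := by
          simpa using ((hasDerivAt_id (0 : ℝ)).mul_const d).const_add p
        have h2 : HasDerivAt (H.val e) (deriv (H.val e) p) (p + 0 * d) := by
          simpa using (H.differentiable e p).hasDerivAt
        exact h2.comp (0 : ℝ) h1
      have hs := (hasDerivAt_iff_tendsto_slope.1 hder).eventually_lt_const (hw e heq)
      have hs' := hs.filter_mono
        (nhdsWithin_mono (0 : ℝ) (fun t (ht : 0 < t) => ht.ne' : Set.Ioi (0 : ℝ) ⊆ {0}ᶜ))
      filter_upwards [hs', self_mem_nhdsWithin] with t ht ht0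
      have ht0' : (0 : ℝ) < t := ht0
      rw [slope_def_field, div_lt_iff₀ (by simpa using ht0')] at ht
      simp only [zero_mul, add_zero] at ht
      linarith
  obtain ⟨t, ht⟩ := (eventually_all.2 key).exists
  have hsub : H.IsSubsolution ω (Finset.univ.sup' Finset.univ_nonempty fun e =>
      H.val e ((G.coboundary u).1 e + ω.1 e + t * (G.coboundary w).1 e)) (u + t • w) := by
    rintro _ e -
    refine le_trans (le_of_eq ?_) (Finset.le_sup' _ (Finset.mem_univ e))
    simp only [modified, DirGraph.coboundary_apply, Pi.add_apply, Pi.smul_apply, smul_eq_mul]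
    congr 1
    ring
  have := H.criticalValue_le hsub
  rw [Finset.le_sup'_iff] at this
  obtain ⟨e, -, he⟩ := this
  exact absurd (ht e) (not_lt.2 he)

/-- The optimality condition at a critical subsolution `u`: a convex combination of the
derivatives of the functions `u ↦ H^ω(e, ⟨du, e⟩)`, over edges `e` where the critical value is
attained, vanishes. -/
lemma exists_critical_weights [Fintype V] [Fintype E] [Nonempty E] {ω : G.Cochain1} {u : V → ℝ}
    (hu : H.IsSubsolution ω (H.criticalValue ω) u) :
    ∃ (ι : Type) (_ : Fintype ι) (l : ι → ℝ≥0) (e : ι → E), ∑ i, l i = 1 ∧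
      (∀ i, H.val (e i) ((G.coboundary u).1 (e i) + ω.1 (e i)) = H.criticalValue ω) ∧
      ∀ f : V → ℝ, ∑ i, (l i : ℝ) * (deriv (H.val (e i))
        ((G.coboundary u).1 (e i) + ω.1 (e i)) * (G.coboundary f).1 (e i)) = 0 := by
  classical
  let d : E → ℝ := fun e => deriv (H.val e) ((G.coboundary u).1 e + ω.1 e)
  let A : Set E := {e | H.val e ((G.coboundary u).1 e + ω.1 e) = H.criticalValue ω}
  let y : E → V → ℝ := fun e =>
    d e • (Pi.single (G.terminal e) 1 - Pi.single (G.origin e) 1)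
  have hy : (0 : V → ℝ) ∈ convexHull ℝ (y '' A) := by
    by_contra h0
    obtain ⟨F, r, hF, hr⟩ := geometric_hahn_banach_closed_point (convex_convexHull ℝ (y '' A))
      ((Set.toFinite (y '' A)).isCompact_convexHull (𝕜 := ℝ)).isClosed h0
    rw [map_zero] at hr
    obtain ⟨e, he, hpos⟩ := H.not_exists_descent hu fun x => F (Pi.single x 1)
    have hlt := (hF _ (subset_convexHull ℝ _ ⟨e, he, rfl⟩)).trans hr
    have hFy : F (y e) = d e * (F (Pi.single (G.terminal e) 1) - F (Pi.single (G.origin e) 1)) := by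
      simp only [y, map_smul, map_sub, smul_eq_mul]
    rw [hFy] at hlt
    exact absurd hpos (not_le.2 hlt)
  rw [mem_convexHull_iff_exists_fintype] at hy
  obtain ⟨ι, _, l, z, hl0, hl1, hz, hsum⟩ := hy
  choose e he hez using hz
  refine ⟨ι, inferInstance, fun i => (l i).toNNReal, e, ?_, he, fun f => ?_⟩
  · rw [← Real.toNNReal_sum_of_nonneg fun i _ => hl0 i, hl1, Real.toNNReal_one]
  · have h1 := congrArg (fun v : V → ℝ => ∑ x, v x * f x) hsum
    simp only [Finset.sum_apply, Pi.smul_apply, smul_eq_mul, Pi.zero_apply, zero_mul,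
      Finset.sum_const_zero, Finset.sum_mul] at h1
    rw [Finset.sum_comm] at h1
    rw [← h1]
    refine Finset.sum_congr rfl fun i _ => ?_
    rw [← hez i, Real.coe_toNNReal _ (hl0 i)]
    have hdu : ∑ x, (Pi.single (G.terminal (e i)) 1 - Pi.single (G.origin (e i)) 1 : V → ℝ) x *
        f x = (G.coboundary f).1 (e i) := by
      simp [sub_mul, Finset.sum_sub_distrib, Pi.single_apply]
    rw [← hdu, Finset.mul_sum, Finset.mul_sum]
    refine Finset.sum_congr rfl fun x _ => ?_
    simp only [y, d, Pi.smul_apply, smul_eq_mul]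
    ring

/-! ### The identity `α = α̃` -/

/-- The set of actions whose infimum is `β(h)` is nonempty, so `β(h)` is never the junk value
`sInf ∅ = 0`. -/
lemma exists_finite_action [Fintype E] [Nonempty E] (h : G.Homology1) :
    ∃ μ ∈ G.closedMeasures, G.rotation μ = h.1 ∧ Integrable H.lagrangianFun μ := by
  obtain ⟨l, v, hc, hr⟩ := G.exists_atomicMeasure_rotation_eq h
  exact ⟨_, hc, hr, G.integrable_atomicMeasure _ _ _ _⟩

/-- The integrated Fenchel inequality. In particular the set of actions whose infimum is `β(h)` is
bounded below. -/
lemma pairing_sub_criticalValue_le_action [Fintype E] [Nonempty E] (ω : G.Cochain1)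
    {h : G.Homology1} {μ : Measure G.TangentBundle} (hμ : μ ∈ G.closedMeasures)
    (hr : G.rotation μ = h.1) (hL : Integrable H.lagrangianFun μ) :
    G.pairing (G.cohomologyClass ω) h - H.criticalValue ω ≤ ∫ x, H.lagrangianFun x ∂μ := by
  obtain ⟨u, hu⟩ := H.exists_critical_subsolution ω
  have := hμ.1
  have hω := G.integrable_cochainFun hμ.2.1 ω
  have hdu := G.integrable_cochainFun hμ.2.1 (G.coboundary u)
  have hpt : ∀ x, G.cochainFun ω x + G.cochainFun (G.coboundary u) x ≤
      H.lagrangianFun x + H.criticalValue ω := by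
    intro x
    obtain ⟨e, q, rfl⟩ := G.exists_tangentPoint_eq x
    have h1 := H.fenchel_inequality e ((G.coboundary u).1 e + ω.1 e) q
    have h2 : H.val e ((G.coboundary u).1 e + ω.1 e) ≤ H.criticalValue ω := hu _ e rfl
    have h3 : H.lagrangianFun (G.tangentPoint e q) = H.lagrangian e q := rfl
    rw [h3, G.cochainFun_tangentPoint, G.cochainFun_tangentPoint]
    linarith
  have hint := integral_mono (hω.add hdu) (hL.add (integrable_const (H.criticalValue ω))) hpt
  simp only [Pi.add_apply] at hint
  rw [integral_add hω hdu, integral_add hL (integrable_const _), hμ.2.2 u, integral_const] at hint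
  simp only [probReal_univ, one_smul, add_zero] at hint
  rw [G.pairing_class, ← hr, G.chainPairing_rotation hμ.2.1]
  linarith

lemma alpha_term_le [Fintype E] [Nonempty E] (ω : G.Cochain1) (h : G.Homology1) :
    G.pairing (G.cohomologyClass ω) h - H.beta h ≤ H.criticalValue ω := by
  obtain ⟨μ, hμ, hr, hL⟩ := H.exists_finite_action h
  have : G.pairing (G.cohomologyClass ω) h - H.criticalValue ω ≤ H.beta h := by
    refine le_csInf ⟨_, μ, hμ, hr, hL, rfl⟩ ?_
    rintro _ ⟨ν, hν, hr', hL', rfl⟩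
    exact H.pairing_sub_criticalValue_le_action ω hν hr' hL'
  linarith

lemma beta_le_action [Fintype E] [Nonempty E] {h : G.Homology1} {μ : Measure G.TangentBundle}
    (hμ : μ ∈ G.closedMeasures) (hr : G.rotation μ = h.1) (hL : Integrable H.lagrangianFun μ) :
    H.beta h ≤ ∫ x, H.lagrangianFun x ∂μ := by
  refine csInf_le ⟨G.pairing (G.cohomologyClass 0) h - H.criticalValue 0, ?_⟩
    ⟨μ, hμ, hr, hL, rfl⟩
  rintro _ ⟨ν, hν, hr', hL', rfl⟩
  exact H.pairing_sub_criticalValue_le_action 0 hν hr' hL'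

/-- The rotation vector of the measure given by the optimality condition attains the bound of
`alpha_term_le`. -/
lemma exists_criticalValue_le_alpha_term [Fintype V] [Fintype E] [Nonempty E] (ω : G.Cochain1) :
    ∃ h : G.Homology1, H.criticalValue ω ≤ G.pairing (G.cohomologyClass ω) h - H.beta h := by
  obtain ⟨u, hu⟩ := H.exists_critical_subsolution ω
  obtain ⟨ι, _, l, e, hl, he, hc⟩ := H.exists_critical_weights hu
  set v : ι → ℝ := fun i => deriv (H.val (e i)) ((G.coboundary u).1 (e i) + ω.1 (e i)) with hv
  have hμ := G.atomicMeasure_mem_closedMeasures l e v hl hc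
  set μ := G.atomicMeasure l e v with hμdef
  have hb := H.beta_le_action (h := ⟨G.rotation μ, G.boundary_rotation hμ⟩) hμ rfl
    (G.integrable_atomicMeasure _ _ _ _)
  refine ⟨⟨G.rotation μ, G.boundary_rotation hμ⟩, ?_⟩
  rw [G.pairing_class, G.chainPairing_rotation hμ.2.1]
  refine le_trans (le_of_eq ?_) (sub_le_sub_left hb _)
  have hl' : ∑ i, (l i : ℝ) = 1 := by exact_mod_cast congrArg NNReal.toReal hl
  rw [hμdef, G.integral_atomicMeasure, G.integral_atomicMeasure]
  simp_rw [G.cochainFun_signedPoint, H.lagrangianFun_signedPoint]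
  have hterm : ∀ i, (l i : ℝ) * (v i * ω.1 (e i)) - l i * H.lagrangian (e i) (v i) =
      l i * H.criticalValue ω - l i * (v i * (G.coboundary u).1 (e i)) := by
    intro i
    rw [hv, H.lagrangian_deriv, he i]
    ring
  rw [← Finset.sum_sub_distrib, Finset.sum_congr rfl fun i _ => hterm i, Finset.sum_sub_distrib,
    hc u, ← Finset.sum_mul, hl', one_mul, sub_zero]

theorem alpha_eq_criticalValue [Fintype V] [Fintype E] [Nonempty E] (ω : G.Cochain1) :
    H.alpha (G.cohomologyClass ω) = H.criticalValue ω := by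
  obtain ⟨h, hh⟩ := H.exists_criticalValue_le_alpha_term ω
  refine le_antisymm (ciSup_le (H.alpha_term_le ω)) (hh.trans ?_)
  refine le_ciSup (f := fun h => G.pairing (G.cohomologyClass ω) h - H.beta h)
    ⟨H.criticalValue ω, ?_⟩ h
  rintro _ ⟨h', rfl⟩
  exact H.alpha_term_le ω h'

/-! ### Minimizers of `α` -/

lemma eq_minimizer_of_val_eq {e : E} {p : ℝ} (h : H.val e p = H.edgeMin e) :
    p = H.minimizer e :=
  (H.strictConvex e).eq_of_isMinOn (fun q _ => h.trans_le (H.minimizer_le e q))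
    (fun q _ => H.minimizer_le e q) (Set.mem_univ _) (Set.mem_univ _)

lemma edgeMin_rev (e : E) : H.edgeMin (G.rev e) = H.edgeMin e := by
  apply le_antisymm
  · rw [edgeMin, edgeMin, H.val_rev e]
    exact H.minimizer_le _ _
  · rw [edgeMin, edgeMin, H.val_rev (G.rev e), G.rev_rev]
    exact H.minimizer_le _ _

lemma minimizer_rev (e : E) : H.minimizer (G.rev e) = - H.minimizer e := by
  refine (H.eq_minimizer_of_val_eq ?_).symm
  rw [← H.val_rev, H.edgeMin_rev, edgeMin]

lemma sigma_edgeMin (e : E) : H.sigma e (H.edgeMin e) = H.minimizer e :=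
  H.eq_minimizer_of_val_eq (H.val_sigma e le_rfl)

lemma deriv_minimizer (e : E) : deriv (H.val e) (H.minimizer e) = 0 :=
  IsLocalMin.deriv_eq_zero (Eventually.of_forall (H.minimizer_le e))

lemma edgeMin_le_a₀ [Fintype E] (e : E) : H.edgeMin e ≤ H.a₀ :=
  le_ciSup (Set.finite_range H.edgeMin).bddAbove e

lemma a₀_le_criticalValue [Fintype E] [Nonempty E] (ω : G.Cochain1) :
    H.a₀ ≤ H.criticalValue ω := by
  obtain ⟨u, hu⟩ := H.exists_critical_subsolution ω
  exact ciSup_le fun e => H.edgeMin_le_of_isSubsolution hu e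

/-- The cochain `e ↦ pₑ`. -/
def minimizerCochain : G.Cochain1 := ⟨H.minimizer, H.minimizer_rev⟩

lemma criticalValue_minimizerCochain [Fintype E] [Nonempty E] :
    H.criticalValue H.minimizerCochain = H.a₀ := by
  refine le_antisymm (H.criticalValue_le (u := 0) fun x e _ => ?_) (H.a₀_le_criticalValue _)
  simpa [modified, minimizerCochain, edgeMin] using H.edgeMin_le_a₀ e

/-- On the Aubry set, `𝒬_c(e) = ∂ₚH(e, σ(e, α̃(c)))`. -/
lemma speedQ_eq_deriv_sigma [Fintype E] [Nonempty E] (ω : G.Cochain1)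
    (e : H.aubrySet (G.cohomologyClass ω)) :
    H.speedQ (G.cohomologyClass ω) e =
      deriv (H.val e) (H.sigma e (H.criticalValue ω)) := by
  obtain ⟨u, hu⟩ := H.exists_critical_subsolution ω
  rw [H.speedQ_eq ω hu, H.coboundary_eq_of_mem_aubrySet hu e.2]
  have : H.modified ω e = fun p => H.val e (p + ω.1 e) := rfl
  rw [this, deriv_comp_add_const, modifiedSigma, sub_add_cancel]

/-- At the level `aₑ` the cycle `(e, -e)` has length zero. -/
lemma mem_cochainAubrySet_of_edgeMin_eq {ω : G.Cochain1} {e : E}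
    (he : H.edgeMin e = H.criticalValue ω) : e ∈ H.cochainAubrySet ω := by
  refine ⟨[e, G.rev e], ⟨G.origin e, by simp, rfl, rfl, G.terminal_rev e⟩, by simp, ?_⟩
  have h2 := H.sigma_edgeMin (G.rev e)
  rw [H.edgeMin_rev, H.minimizer_rev, he] at h2
  have h1 := H.sigma_edgeMin e
  rw [he] at h1
  simp [intrinsicLength, modifiedSigma, h1, h2, ω.2 e]

lemma exists_speedQ_eq_zero_iff [Fintype E] [Nonempty E] (ω : G.Cochain1) :
    (∃ e : H.aubrySet (G.cohomologyClass ω), H.speedQ (G.cohomologyClass ω) e = 0) ↔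
      H.criticalValue ω = H.a₀ := by
  constructor
  · rintro ⟨e, he⟩
    rw [H.speedQ_eq_deriv_sigma] at he
    obtain ⟨u, hu⟩ := H.exists_critical_subsolution ω
    have hle := H.edgeMin_le_of_isSubsolution hu e
    have h1 := H.val_add_deriv_mul_le e (H.sigma e (H.criticalValue ω)) (H.minimizer e)
    rw [he, H.val_sigma _ hle, zero_mul, add_zero] at h1
    exact le_antisymm (h1.trans (H.edgeMin_le_a₀ e)) (H.a₀_le_criticalValue ω)
  · intro h
    obtain ⟨e, he⟩ := exists_eq_ciSup_of_finite (f := H.edgeMin)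
    have he' : H.edgeMin e = H.criticalValue ω := he.trans h.symm
    refine ⟨⟨e, H.mem_cochainAubrySet_of_edgeMin_eq he'⟩, ?_⟩
    rw [H.speedQ_eq_deriv_sigma, ← he', H.sigma_edgeMin, H.deriv_minimizer]

end Hamiltonian

end AubryMather

end

theorem proposition8p5 {V E : Type*} [Fintype V] [Fintype E] [Nonempty E]
    (G : AubryMather.DirGraph V E) (hconn : G.Connected) (hloop : G.NoLoops)
    (H : AubryMather.Hamiltonian G) :
    IsLeast (Set.range H.alpha) H.a₀ ∧
      ∀ c : G.Cohomology1,
        (∀ c' : G.Cohomology1, H.alpha c ≤ H.alpha c') ↔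
          ∃ e : H.aubrySet c, H.speedQ c e = 0 := by
  have hleast : IsLeast (Set.range H.alpha) H.a₀ := by
    refine ⟨⟨G.cohomologyClass H.minimizerCochain, ?_⟩, ?_⟩
    · rw [H.alpha_eq_criticalValue, H.criticalValue_minimizerCochain]
    · rintro _ ⟨c, rfl⟩
      obtain ⟨ω, rfl⟩ := Submodule.Quotient.mk_surjective _ c
      exact (H.a₀_le_criticalValue ω).trans_eq (H.alpha_eq_criticalValue ω).symm
  refine ⟨hleast, fun c => ?_⟩
  obtain ⟨ω, rfl⟩ : ∃ ω, G.cohomologyClass ω = c := Submodule.Quotient.mk_surjective _ c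
  rw [H.exists_speedQ_eq_zero_iff, ← H.alpha_eq_criticalValue]
  refine ⟨fun h => ?_, fun h c' => h.trans_le (hleast.2 ⟨c', rfl⟩)⟩
  obtain ⟨c₀, hc₀⟩ := hleast.1
  exact le_antisymm ((h c₀).trans_eq hc₀) (hleast.2 ⟨_, rfl⟩)
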